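/- Let $\gamma$ denote Euler's constant, let $\zeta^{(\ell)}$ denote the $\ell$-th derivative of the Riemann zeta function, and write $\log_2 T = \log\log T$ and $\log_3 T = \log\log\log T$. There are absolute constants $C$ and $T_0$ such that for every real $T \ge T_0$ and every positive integer $\ell \le (\log T)/(\log_2 T)$, \[ \max_{T\le t\le 2T}\bigl|\zeta^{(\ell)}(1+it)\bigr| \;\ge\; e^{\gamma}\cdot \ell^{\ell}\cdot(\ell+1)^{-(\ell+1)}\cdot\bigl(\log_2 T-\log_3 T-C\bigr)^{\ell+1}. \] In other words, if $T$ is sufficiently large, then uniformly for all positive integers $\ell \le (\log T)/(\log_2 T)$, the maximum is at least $e^{\gamma}\,\ell^{\ell}(\ell+1)^{-(\ell+1)}\bigl(\log_2 T-\log_3 T+O(1)\bigr)^{\ell+1}$, where the implied constant in $O(1)$ is absolute. -/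

import Mathlib

/-!
The proof is by the resonance method. On the line `Re s = 1`, Cauchy's estimates on a circle of
radius `(l + 1) / log X` about `1 + it` transfer the approximation of `ζ` by its truncated
Dirichlet series to the derivatives, so that `(-1) ^ l ζ^(l) (1 + it)` is
`∑ n ≤ X, (log n) ^ l / n * n ^ (-it)` up to `O(1) ^ (l + 1)` when `X ≈ T ^ 2`. This polynomial is
averaged against `|∑ a ∣ D, a ^ (-it)| ^ 2` under a Gaussian centred at `3T / 2`, with `D` the
`E`-th power of a primorial and `D ^ 2 ≤ T`; only the terms with `n * a = b` contribute to the
mean. If `n ≤ Y` has few prime factors compared with `E`, then `n * a ∣ D` for almost all divisors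
`a` of `D`, so the maximum is at least about
`∑ n ≤ Y, (log n) ^ l / n ≈ (log Y) ^ (l + 1) / (l + 1)`, and `D ^ 2 ≤ T` permits
`log Y = log log T - log log log T + O(1)`.

This gives every constant `c < 1` in front of `(log Y) ^ (l + 1) / (l + 1)`. As `exp γ < 2` and
`2 * l ^ l ≤ (l + 1) ^ l`, the constant `exp γ * l ^ l / (l + 1) ^ (l + 1)` is covered by
`c = exp γ / 2`.
-/

open Filter Topology MeasureTheory ProbabilityTheory Complex
open scoped NNReal ArithmeticFunction.Omega

/-! ### Truncation of the zeta function and its derivatives -/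

/-- The truncated Dirichlet series of `ζ`, multiplied by `s - 1` and completed by the boundary term
`N ^ (1 - s)`. Clearing the pole makes it entire for `N ≠ 0`, and it converges to
`riemannZeta₁ s`, the entire version of `(s - 1) * ζ s`, on the half-plane `0 < re s`. -/
noncomputable def correctedZetaSum (N : ℕ) (s : ℂ) : ℂ :=
  (s - 1) * ∑ n ∈ Finset.Icc 1 N, (n : ℂ) ^ (-s) + (N : ℂ) ^ (1 - s)

lemma hasDerivAt_cpow_sub_cpow_add_mul (s : ℂ) (x : ℝ) {y : ℝ} (hy : 0 < y) :
    HasDerivAt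
      (fun z : ℝ ↦ (z : ℂ) ^ (1 - s) - (x : ℂ) ^ (1 - s) + (s - 1) * ((z - x : ℂ) * (z : ℂ) ^ (-s)))
      (-((s - 1) * s * ((y - x : ℂ) * (y : ℂ) ^ (-s - 1)))) y := by
  have hslit : (y : ℂ) ∈ slitPlane := ofReal_mem_slitPlane.mpr hy
  have h₁ := ((hasDerivAt_id (y : ℂ)).cpow_const (c := 1 - s) hslit).comp_ofReal
  have h₂ := ((hasDerivAt_id (y : ℂ)).cpow_const (c := -s) hslit).comp_ofReal
  have h₃ : HasDerivAt (fun z : ℝ ↦ (z : ℂ) - x) 1 y :=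
    (hasDerivAt_id y).ofReal_comp.sub_const _
  refine ((h₁.sub_const _).add ((h₃.mul h₂).const_mul (s - 1))).congr_deriv ?_
  simp only [id, sub_sub_cancel_left]
  ring

lemma norm_cpow_sub_add_le {s : ℂ} {σ x : ℝ} (hσ : 0 < σ) (hs : σ ≤ s.re) (hx : 1 ≤ x) :
    ‖((x + 1 : ℝ) : ℂ) ^ (1 - s) - (x : ℂ) ^ (1 - s) + (s - 1) * ((x + 1 : ℝ) : ℂ) ^ (-s)‖ ≤
      ‖s - 1‖ * ‖s‖ / σ * (x ^ (-σ) - (x + 1) ^ (-σ)) := by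
  have deriv_right : ∀ y : ℝ, 0 < y → HasDerivAt
      (fun z : ℝ ↦ ‖s - 1‖ * ‖s‖ / σ * (x ^ (-σ) - z ^ (-σ)))
      (‖s - 1‖ * ‖s‖ * y ^ (-σ - 1)) y := by
    intro y hy
    refine (((Real.hasDerivAt_rpow_const (p := -σ) (Or.inl hy.ne')).const_sub _).const_mul
      _).congr_deriv ?_
    field_simp
  have hpos : ∀ y ∈ Set.Icc x (x + 1), 0 < y := fun y hy ↦ by linarith [hy.1]
  have h := image_norm_le_of_norm_deriv_right_le_deriv_boundary'
    (fun y hy ↦ (hasDerivAt_cpow_sub_cpow_add_mul s x (hpos y hy)).continuousAt.continuousWithinAt)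
    (fun y hy ↦ (hasDerivAt_cpow_sub_cpow_add_mul s x (hpos y ⟨hy.1, hy.2.le⟩)).hasDerivWithinAt)
    (by simp)
    (fun y hy ↦ (deriv_right y (hpos y hy)).continuousAt.continuousWithinAt)
    (fun y hy ↦ (deriv_right y (hpos y ⟨hy.1, hy.2.le⟩)).hasDerivWithinAt)
    (fun y hy ↦ ?_) (x := x + 1) ⟨by linarith, le_rfl⟩
  · simpa using h
  · have h₁ : ‖(y : ℂ) - x‖ ≤ 1 := by
      rw [← ofReal_sub, norm_real, Real.norm_of_nonneg (by linarith [hy.1])]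
      linarith [hy.2]
    have h₂ : ‖(y : ℂ) ^ (-s - 1)‖ ≤ y ^ (-σ - 1) := by
      rw [norm_cpow_eq_rpow_re_of_pos (by linarith [hy.1])]
      exact Real.rpow_le_rpow_of_exponent_le (by linarith [hy.1]) (by simpa using hs)
    simp only [norm_neg, norm_mul]
    gcongr
    exact (mul_le_mul h₁ h₂ (norm_nonneg _) zero_le_one).trans_eq (one_mul _)

lemma norm_correctedZetaSum_succ_sub_le {s : ℂ} {σ : ℝ} (hσ : 0 < σ) (hs : σ ≤ s.re) {N : ℕ}
    (hN : 1 ≤ N) :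
    ‖correctedZetaSum (N + 1) s - correctedZetaSum N s‖ ≤
      ‖s - 1‖ * ‖s‖ / σ * ((N : ℝ) ^ (-σ) - ((N + 1 : ℕ) : ℝ) ^ (-σ)) := by
  have h := norm_cpow_sub_add_le hσ hs (x := N) (by exact_mod_cast hN)
  convert h using 2
  · rw [correctedZetaSum, correctedZetaSum, Finset.sum_Icc_succ_top (by omega)]
    push_cast
    ring
  · push_cast
    ring

lemma differentiable_natCast_cpow_neg {n : ℕ} (hn : n ≠ 0) :
    Differentiable ℂ fun z : ℂ ↦ (n : ℂ) ^ (-z) :=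
  fun _ ↦ differentiableAt_id.neg.const_cpow (Or.inl (by exact_mod_cast hn))

lemma differentiable_sum_natCast_cpow_neg (X : ℕ) :
    Differentiable ℂ fun z : ℂ ↦ ∑ n ∈ Finset.Icc 1 X, (n : ℂ) ^ (-z) :=
  Differentiable.fun_sum fun _ hn ↦
    differentiable_natCast_cpow_neg (Nat.one_le_iff_ne_zero.mp (Finset.mem_Icc.mp hn).1)

lemma differentiable_correctedZetaSum {N : ℕ} (hN : N ≠ 0) :
    Differentiable ℂ (correctedZetaSum N) := by
  have hpow : Differentiable ℂ fun s : ℂ ↦ (N : ℂ) ^ (1 - s) := fun s ↦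
    (differentiableAt_id.const_sub 1).const_cpow (Or.inl (by exact_mod_cast hN))
  exact ((differentiable_id.sub_const 1).mul (differentiable_sum_natCast_cpow_neg N)).add hpow

lemma tendsto_correctedZetaSum_of_one_lt_re {s : ℂ} (hs : 1 < s.re) :
    Tendsto (correctedZetaSum · s) atTop (𝓝 (riemannZeta₁ s)) := by
  have hs₁ : s ≠ 1 := ne_of_apply_ne re (by rw [one_re]; exact hs.ne')
  have hsum : Tendsto (fun N : ℕ ↦ ∑ n ∈ Finset.Icc 1 N, (n : ℂ) ^ (-s)) atTop
      (𝓝 (riemannZeta s)) := by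
    have h := ((summable_nat_add_iff 1).mpr
      (summable_one_div_nat_cpow.mpr hs)).hasSum.tendsto_sum_nat
    simp only [Nat.cast_add, Nat.cast_one, ← zeta_eq_tsum_one_div_nat_add_one_cpow hs] at h
    refine h.congr fun N ↦ ?_
    have hshift := Finset.sum_Ico_add' (fun n : ℕ ↦ (n : ℂ) ^ (-s)) 0 N 1
    rw [zero_add, Finset.Ico_add_one_right_eq_Icc] at hshift
    simpa [cpow_neg] using hshift
  have hpow : Tendsto (fun N : ℕ ↦ (N : ℂ) ^ (1 - s)) atTop (𝓝 0) := by
    refine tendsto_zero_iff_norm_tendsto_zero.mpr (Tendsto.congr' ?_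
      ((tendsto_rpow_neg_atTop (sub_pos.mpr hs)).comp tendsto_natCast_atTop_atTop))
    filter_upwards [eventually_gt_atTop 0] with N hN
    simp [norm_natCast_cpow_of_pos hN]
  have h := (hsum.const_mul (s - 1)).add hpow
  rwa [add_zero, riemannZeta_eq_inv_sub_mul hs₁, mul_inv_cancel_left₀ (sub_ne_zero.mpr hs₁)] at h

lemma summable_sub_succ_of_antitone {f : ℕ → ℝ} (hf : Antitone f) (hf₀ : ∀ n, 0 ≤ f n) :
    Summable fun n ↦ f n - f (n + 1) := by
  refine summable_of_sum_range_le (c := f 0) (fun n ↦ sub_nonneg.mpr (hf n.le_succ)) fun n ↦ ?_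
  rw [Finset.sum_range_sub']
  linarith [hf₀ n]

lemma exists_differentiableOn_tendsto_correctedZetaSum {σ R : ℝ} (hσ : 0 < σ) :
    ∃ g : ℂ → ℂ, DifferentiableOn ℂ g ({s | σ < s.re} ∩ Metric.ball 0 R) ∧
      ∀ s ∈ {s | σ < s.re} ∩ Metric.ball 0 R, Tendsto (correctedZetaSum · s) atTop (𝓝 (g s)) := by
  set U : Set ℂ := {s | σ < s.re} ∩ Metric.ball 0 R
  set u : ℕ → ℝ := fun k ↦
    (R + 1) * R / σ * (((k + 1 : ℕ) : ℝ) ^ (-σ) - ((k + 2 : ℕ) : ℝ) ^ (-σ))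
  have hUo : IsOpen U := (isOpen_lt continuous_const continuous_re).inter Metric.isOpen_ball
  have hle : ∀ (k : ℕ), ∀ s ∈ U,
      ‖correctedZetaSum (k + 2) s - correctedZetaSum (k + 1) s‖ ≤ u k := by
    intro k s hs
    have hsR : ‖s‖ ≤ R := (mem_ball_zero_iff.mp hs.2).le
    have hmono : ((k + 2 : ℕ) : ℝ) ^ (-σ) ≤ ((k + 1 : ℕ) : ℝ) ^ (-σ) :=
      Real.rpow_le_rpow_of_nonpos (by positivity) (by push_cast; linarith) (by linarith)
    have hs₁R : ‖s - 1‖ ≤ R + 1 := (norm_sub_le _ _).trans (by simpa using hsR)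
    have hR : 0 ≤ R := (norm_nonneg s).trans hsR
    refine (norm_correctedZetaSum_succ_sub_le hσ hs.1.le (by omega)).trans ?_
    exact mul_le_mul_of_nonneg_right (by gcongr) (sub_nonneg.mpr hmono)
  have hsummable : Summable u := by
    refine Summable.mul_left _ ?_
    refine summable_sub_succ_of_antitone (f := fun k : ℕ ↦ ((k + 1 : ℕ) : ℝ) ^ (-σ))
      (fun j k hjk ↦ ?_) fun k ↦ by positivity
    exact Real.rpow_le_rpow_of_nonpos (by positivity) (by gcongr) (by linarith)
  refine ⟨fun s ↦ correctedZetaSum 1 s +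
    ∑' k : ℕ, (correctedZetaSum (k + 2) s - correctedZetaSum (k + 1) s), ?_, fun s hs ↦ ?_⟩
  · exact (differentiable_correctedZetaSum one_ne_zero).differentiableOn.add
      (differentiableOn_tsum_of_summable_norm hsummable (fun k ↦
        ((differentiable_correctedZetaSum (by omega)).sub
          (differentiable_correctedZetaSum (by omega))).differentiableOn) hUo hle)
  · have h := ((Summable.of_norm_bounded hsummable
      fun k ↦ hle k s hs).hasSum.tendsto_sum_nat).const_add (correctedZetaSum 1 s)
    refine (tendsto_add_atTop_iff_nat 1).mp (h.congr fun N ↦ ?_)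
    rw [Finset.sum_range_sub (fun k ↦ correctedZetaSum (k + 1) s), zero_add, add_sub_cancel]

lemma tendsto_correctedZetaSum {s : ℂ} (hs : 0 < s.re) :
    Tendsto (correctedZetaSum · s) atTop (𝓝 (riemannZeta₁ s)) := by
  obtain ⟨g, hg, hlim⟩ := exists_differentiableOn_tendsto_correctedZetaSum
    (σ := s.re / 2) (R := ‖s‖ + s.re / 2 + 3) (by linarith)
  set U : Set ℂ := {z | s.re / 2 < z.re} ∩ Metric.ball 0 (‖s‖ + s.re / 2 + 3)
  have hUo : IsOpen U := (isOpen_lt continuous_const continuous_re).inter Metric.isOpen_ball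
  have hUc : Convex ℝ U := (convex_halfSpace_re_gt _).inter (convex_ball _ _)
  have hsU : s ∈ U :=
    ⟨half_lt_self hs, mem_ball_zero_iff.mpr (by linarith)⟩
  have h₂ : ((s.re / 2 + 2 : ℝ) : ℂ) ∈ U := by
    refine ⟨by simp, ?_⟩
    rw [mem_ball_zero_iff, norm_real, Real.norm_of_nonneg (by linarith)]
    linarith [norm_nonneg s]
  have heq : g =ᶠ[𝓝 ((s.re / 2 + 2 : ℝ) : ℂ)] riemannZeta₁ := by
    filter_upwards [hUo.mem_nhds h₂,
      (isOpen_lt continuous_const continuous_re).mem_nhds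
        (show 1 < ((s.re / 2 + 2 : ℝ) : ℂ).re by rw [ofReal_re]; linarith)] with z hz hz₁
    exact tendsto_nhds_unique (hlim z hz) (tendsto_correctedZetaSum_of_one_lt_re hz₁)
  have hEqOn := (hg.analyticOnNhd hUo).eqOn_of_preconnected_of_eventuallyEq
    (differentiable_riemannZeta₁.differentiableOn.analyticOnNhd hUo) hUc.isPreconnected h₂ heq
  exact hEqOn hsU ▸ hlim s hsU

lemma norm_correctedZetaSum_sub_le {s : ℂ} (hs : 0 < s.re) {X N : ℕ} (hX : 1 ≤ X) (hXN : X ≤ N) :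
    ‖correctedZetaSum N s - correctedZetaSum X s‖ ≤
      ‖s - 1‖ * ‖s‖ / s.re * ((X : ℝ) ^ (-s.re) - (N : ℝ) ^ (-s.re)) := by
  induction N, hXN using Nat.le_induction with
  | base => simp
  | succ N hN ih =>
    have h := norm_correctedZetaSum_succ_sub_le hs le_rfl (hX.trans hN)
    calc _ ≤ _ := norm_sub_le_norm_sub_add_norm_sub _ (correctedZetaSum N s) _
      _ ≤ _ := add_le_add h ih
      _ = _ := by ring

theorem norm_riemannZeta_sub_sum_le {s : ℂ} (hs : 0 < s.re) (hs₁ : s ≠ 1) {X : ℕ} (hX : 1 ≤ X) :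
    ‖riemannZeta s - (∑ n ∈ Finset.Icc 1 X, (n : ℂ) ^ (-s) + (X : ℂ) ^ (1 - s) / (s - 1))‖ ≤
      ‖s‖ / s.re * (X : ℝ) ^ (-s.re) := by
  have hs₁' : s - 1 ≠ 0 := sub_ne_zero.mpr hs₁
  have hlim : ‖riemannZeta₁ s - correctedZetaSum X s‖ ≤
      ‖s - 1‖ * ‖s‖ / s.re * (X : ℝ) ^ (-s.re) := by
    refine le_of_tendsto ((tendsto_correctedZetaSum hs).sub_const _).norm ?_
    filter_upwards [eventually_ge_atTop X] with N hN
    refine (norm_correctedZetaSum_sub_le hs hX hN).trans ?_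
    gcongr
    exact sub_le_self _ (by positivity)
  have hdiv : riemannZeta s - (∑ n ∈ Finset.Icc 1 X, (n : ℂ) ^ (-s) + (X : ℂ) ^ (1 - s) / (s - 1)) =
      (s - 1)⁻¹ * (riemannZeta₁ s - correctedZetaSum X s) := by
    rw [riemannZeta_eq_inv_sub_mul hs₁, correctedZetaSum]
    field_simp
  have hnorm : ‖s - 1‖ ≠ 0 := norm_ne_zero_iff.mpr hs₁'
  rw [hdiv, norm_mul, norm_inv]
  calc _ ≤ ‖s - 1‖⁻¹ * (‖s - 1‖ * ‖s‖ / s.re * (X : ℝ) ^ (-s.re)) := by gcongr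
    _ = _ := by field_simp [hnorm]

lemma iteratedDeriv_natCast_cpow_neg {n : ℕ} (hn : n ≠ 0) (l : ℕ) (s : ℂ) :
    iteratedDeriv l (fun z : ℂ ↦ (n : ℂ) ^ (-z)) s =
      (-1) ^ l * ((Real.log n : ℂ) ^ l * (n : ℂ) ^ (-s)) := by
  have h : ∀ z : ℂ, (n : ℂ) ^ (-z) = cexp (-(Real.log n : ℂ) * z) := fun z ↦ by
    rw [cpow_def_of_ne_zero (by exact_mod_cast hn), ← natCast_log]
    ring_nf
  simp only [h, iteratedDeriv_cexp_const_mul, neg_pow (Real.log n : ℂ), mul_assoc]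

lemma iteratedDeriv_sum_natCast_cpow_neg (X l : ℕ) (s : ℂ) :
    iteratedDeriv l (fun z : ℂ ↦ ∑ n ∈ Finset.Icc 1 X, (n : ℂ) ^ (-z)) s =
      (-1) ^ l * ∑ n ∈ Finset.Icc 1 X, (Real.log n : ℂ) ^ l * (n : ℂ) ^ (-s) := by
  have hne : ∀ n ∈ Finset.Icc 1 X, n ≠ 0 := fun n hn ↦ by
    rw [Finset.mem_Icc] at hn
    omega
  rw [iteratedDeriv_fun_sum fun n hn ↦
    (differentiable_natCast_cpow_neg (hne n hn)).contDiff.contDiffAt, Finset.mul_sum]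
  exact Finset.sum_congr rfl fun n hn ↦ iteratedDeriv_natCast_cpow_neg (hne n hn) l s

lemma sub_le_im_of_mem_closedBall {t r : ℝ} {s : ℂ} (hs : s ∈ Metric.closedBall (1 + t * I) r) :
    t - r ≤ s.im := by
  have him : (s - (1 + t * I)).im = s.im - t := by simp
  have h := (abs_le.mp ((abs_im_le_norm _).trans (mem_closedBall_iff_norm.mp hs))).1
  linarith

lemma one_sub_le_re_of_mem_closedBall {t r : ℝ} {s : ℂ}
    (hs : s ∈ Metric.closedBall (1 + t * I) r) : 1 - r ≤ s.re := by
  have hre : (s - (1 + t * I)).re = s.re - 1 := by simp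
  have h := (abs_le.mp ((abs_re_le_norm _).trans (mem_closedBall_iff_norm.mp hs))).1
  linarith

lemma ne_one_of_mem_closedBall_one_add_mul_I {t r : ℝ} (hr : r < t) {s : ℂ}
    (hs : s ∈ Metric.closedBall (1 + t * I) r) : s ≠ 1 := by
  rintro rfl
  have h := sub_le_im_of_mem_closedBall hs
  rw [one_im] at h
  linarith

lemma norm_riemannZeta_sub_sum_le_of_mem_closedBall {t r : ℝ} (ht : 1 ≤ t) (hr : r ≤ 1 / 2) {X : ℕ}
    (hX : 1 ≤ X) {s : ℂ} (hs : s ∈ Metric.closedBall (1 + t * I) r) :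
    ‖riemannZeta s - ∑ n ∈ Finset.Icc 1 X, (n : ℂ) ^ (-s)‖ ≤
      (X : ℝ) ^ r * (2 / t + 6 * t / X) := by
  have hs₁ : s ≠ 1 := ne_one_of_mem_closedBall_one_add_mul_I (by linarith) hs
  have hre : 1 - r ≤ s.re := one_sub_le_re_of_mem_closedBall hs
  have him : t / 2 ≤ ‖s - 1‖ := by
    have h := (le_abs_self _).trans (abs_im_le_norm (s - 1))
    rw [sub_im, one_im, sub_zero] at h
    linarith [sub_le_im_of_mem_closedBall hs]
  have hnorm : ‖s‖ ≤ 3 * t := by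
    have h₁ : ‖s‖ ≤ ‖s - (1 + t * I)‖ + (‖(1 : ℂ)‖ + ‖t * I‖) := by
      simpa using norm_add_le_of_le (le_refl ‖s - (1 + t * I)‖) (norm_add_le 1 (t * I : ℂ))
    have h₂ : ‖(t * I : ℂ)‖ = t := by simp [abs_of_nonneg (by linarith : 0 ≤ t)]
    rw [h₂, norm_one] at h₁
    linarith [mem_closedBall_iff_norm.mp hs]
  have hX₀ : (0 : ℝ) < X := by exact_mod_cast hX
  have hX₁ : (1 : ℝ) ≤ X := by exact_mod_cast hX
  have h₁ := norm_riemannZeta_sub_sum_le (by linarith) hs₁ hX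
  have h₂ : ‖(X : ℂ) ^ (1 - s) / (s - 1)‖ ≤ (X : ℝ) ^ r / (t / 2) := by
    rw [norm_div, norm_natCast_cpow_of_pos hX, sub_re, one_re]
    gcongr
    linarith
  have h₃ : ‖s‖ / s.re * (X : ℝ) ^ (-s.re) ≤ 3 * t / (1 / 2) * (X : ℝ) ^ (r - 1) := by
    gcongr <;> linarith
  rw [Real.rpow_sub_one hX₀.ne'] at h₃
  calc _ = ‖(riemannZeta s - (∑ n ∈ Finset.Icc 1 X, (n : ℂ) ^ (-s) + (X : ℂ) ^ (1 - s) / (s - 1)))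
        + (X : ℂ) ^ (1 - s) / (s - 1)‖ := by congr 1; ring
    _ ≤ 3 * t / (1 / 2) * ((X : ℝ) ^ r / X) + (X : ℝ) ^ r / (t / 2) :=
      norm_add_le_of_le (h₁.trans h₃) h₂
    _ = _ := by field_simp; ring

theorem norm_iteratedDeriv_riemannZeta_sub_sum_le {t : ℝ} (ht : 1 ≤ t) {l X : ℕ}
    (hl : 2 * ((l : ℝ) + 1) ≤ Real.log X) :
    ‖iteratedDeriv l riemannZeta (1 + t * I) - (-1) ^ l *
        ∑ n ∈ Finset.Icc 1 X, (Real.log n : ℂ) ^ l * (n : ℂ) ^ (-(1 + t * I))‖ ≤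
      Real.exp (l + 1) * Real.log X ^ l * (2 / t + 6 * t / X) := by
  have hlog : 0 < Real.log X := lt_of_lt_of_le (by positivity) hl
  have hX : 1 ≤ X := Nat.one_le_iff_ne_zero.mpr <| by
    rintro rfl
    exact hlog.ne' (by rw [Nat.cast_zero, Real.log_zero])
  -- This radius essentially minimises the Cauchy bound `X ^ r / r ^ l`.
  set r : ℝ := (l + 1) / Real.log X with hr
  have hr₀ : 0 < r := by positivity
  have hr₁ : r ≤ 1 / 2 := by rw [hr, div_le_iff₀ hlog]; linarith
  have hexp : (X : ℝ) ^ r = Real.exp (l + 1) := by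
    rw [Real.rpow_def_of_pos (by exact_mod_cast hX), hr, mul_div_cancel₀ _ hlog.ne']
  have hne : ∀ s ∈ Metric.closedBall (1 + t * I) r, s ≠ 1 := fun s ↦
    ne_one_of_mem_closedBall_one_add_mul_I (by linarith)
  have hone : (1 : ℂ) + t * I ≠ 1 := hne _ (Metric.mem_closedBall_self hr₀.le)
  have hsum := differentiable_sum_natCast_cpow_neg X
  have hdiff : DifferentiableOn ℂ
      (fun z ↦ riemannZeta z - ∑ n ∈ Finset.Icc 1 X, (n : ℂ) ^ (-z))
      (Metric.closedBall (1 + t * I) r) := fun z hz ↦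
    ((differentiableAt_riemannZeta (hne z hz)).sub hsum.differentiableAt).differentiableWithinAt
  have hcauchy := norm_iteratedDeriv_le_of_forall_mem_sphere_norm_le l hr₀
    (hdiff.mono Metric.closure_ball_subset_closedBall).diffContOnCl
    fun z hz ↦ norm_riemannZeta_sub_sum_le_of_mem_closedBall ht hr₁ hX
      (Metric.sphere_subset_closedBall hz)
  rw [iteratedDeriv_fun_sub (analyticOn_riemannZeta _ hone).contDiffAt hsum.contDiff.contDiffAt,
    iteratedDeriv_sum_natCast_cpow_neg, hexp] at hcauchy
  refine hcauchy.trans ?_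
  have hfact : (l.factorial : ℝ) ≤ (l + 1) ^ l := by
    exact_mod_cast (Nat.factorial_le_pow l).trans (Nat.pow_le_pow_left l.le_succ l)
  calc _ ≤ ((l : ℝ) + 1) ^ l * (Real.exp (l + 1) * (2 / t + 6 * t / X)) / r ^ l := by gcongr
    _ = _ := by rw [hr, div_pow]; field_simp

/-! ### The resonance inequality -/

lemma one_div_succ_le_abs_log_sub_log {m k D : ℕ} (hm : m ≠ 0) (hk : k ≠ 0) (hkD : k ≤ D)
    (hne : m ≠ k) : 1 / ((D : ℝ) + 1) ≤ |Real.log m - Real.log k| := by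
  have hm₀ : (0 : ℝ) < m := by positivity
  have hk₀ : (0 : ℝ) < k := by positivity
  have hD : (k : ℝ) ≤ D := by exact_mod_cast hkD
  have hinv : 1 / ((D : ℝ) + 1) ≤ 1 / (k + 1) := by gcongr
  refine hinv.trans ?_
  rcases lt_or_gt_of_ne hne with h | h
  · have hmk : (m : ℝ) + 1 ≤ k := by exact_mod_cast h
    have hlog := Real.one_sub_inv_le_log_of_pos (div_pos hk₀ hm₀)
    rw [Real.log_div hk₀.ne' hm₀.ne', inv_div] at hlog
    rw [abs_sub_comm]
    refine le_trans ?_ (hlog.trans (le_abs_self _))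
    rw [one_sub_div hk₀.ne', div_le_div_iff₀ (by positivity) hk₀]
    nlinarith
  · have hmk : (k : ℝ) + 1 ≤ m := by exact_mod_cast h
    have hlog := Real.one_sub_inv_le_log_of_pos (div_pos hm₀ hk₀)
    rw [Real.log_div hm₀.ne' hk₀.ne', inv_div] at hlog
    refine le_trans ?_ (hlog.trans (le_abs_self _))
    rw [one_sub_div hm₀.ne', div_le_div_iff₀ (by positivity) hm₀]
    nlinarith

lemma norm_charFun_gaussianReal (τ : ℝ) (v : ℝ≥0) (x : ℝ) :
    ‖charFun (gaussianReal τ v) x‖ = Real.exp (-(v * x ^ 2 / 2)) := by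
  have h : (x * τ * I - v * x ^ 2 / 2 : ℂ) = ((-(v * x ^ 2 / 2) : ℝ) : ℂ) + (x * τ : ℝ) * I := by
    push_cast
    ring
  rw [charFun_gaussianReal, h, exp_add, norm_mul, norm_exp_ofReal_mul_I, mul_one, norm_exp_ofReal]

lemma norm_charFun_gaussianReal_log_sub_log_le {m k D : ℕ} (hm : m ≠ 0) (hk : k ≠ 0) (hkD : k ≤ D)
    (hne : m ≠ k) (τ : ℝ) (v : ℝ≥0) :
    ‖charFun (gaussianReal τ v) (Real.log k - Real.log m)‖ ≤
      Real.exp (-(v / (2 * ((D : ℝ) + 1) ^ 2))) := by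
  have hgap := one_div_succ_le_abs_log_sub_log hm hk hkD hne
  have hsq : (1 / ((D : ℝ) + 1)) ^ 2 ≤ (Real.log k - Real.log m) ^ 2 := by
    rw [← sq_abs (Real.log k - Real.log m), abs_sub_comm]
    gcongr
  rw [norm_charFun_gaussianReal, Real.exp_le_exp, neg_le_neg_iff]
  calc (v : ℝ) / (2 * ((D : ℝ) + 1) ^ 2) = v * (1 / ((D : ℝ) + 1)) ^ 2 / 2 := by field_simp
    _ ≤ _ := by gcongr

lemma measureReal_gaussianReal_le_abs_sub (τ : ℝ) (v : ℝ≥0) {η : ℝ} (hη : 0 ≤ η) :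
    (gaussianReal τ v).real {t | η ≤ |t - τ|} ≤ 2 * Real.exp (-η ^ 2 / (2 * v)) := by
  have hsub : HasSubgaussianMGF (fun t ↦ t - τ) v (gaussianReal τ v) := by
    have hmap : (gaussianReal τ v).map (fun t ↦ t - τ) = gaussianReal 0 v := by
      rw [gaussianReal_map_sub_const, sub_self]
    refine ⟨fun t ↦ ?_, fun t ↦ by rw [mgf_gaussianReal hmap, zero_mul, zero_add]⟩
    simpa [mul_sub, Real.exp_sub] using (integrable_exp_mul_gaussianReal t).div_const _
  have hset : {t | η ≤ |t - τ|} = {t | η ≤ t - τ} ∪ {t | η ≤ (-fun t ↦ t - τ) t} := by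
    ext t
    simp only [Set.mem_ofPred_eq, Set.mem_union, Pi.neg_apply, le_abs]
  rw [hset, two_mul]
  exact (measureReal_union_le _ _).trans
    (add_le_add (hsub.measure_ge_le hη) (hsub.neg.measure_ge_le hη))

/-- The Dirichlet polynomial with frequencies `s` and weights `w` on the vertical axis, at the point
`it`. It plays two roles: the weights `1` give the resonator, and the weights `zetaWeight l` give
the derivatives of `ζ` on the line `re s = 1`. -/
noncomputable def dirichletPoly (s : Finset ℕ) (w : ℕ → ℝ) (t : ℝ) : ℂ :=
  ∑ n ∈ s, (w n : ℂ) * (n : ℂ) ^ (-(t * I))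

/-- The diagonal terms `n * a = b`, with `n ∈ s` and `a, b ∈ A`, of the mean of a Dirichlet
polynomial against the squared modulus of the resonator `∑ a ∈ A, a ^ (-it)`; for given `n` they are
counted by the `a ∈ A` with `n * a ∈ A`. -/
def resonanceSum (s : Finset ℕ) (w : ℕ → ℝ) (A : Finset ℕ) : ℝ :=
  ∑ n ∈ s, w n * ({a ∈ A | n * a ∈ A} : Finset ℕ).card

section Resonance

variable {s A : Finset ℕ} {w : ℕ → ℝ}

lemma natCast_cpow_neg_mul_I {n : ℕ} (hn : n ≠ 0) (t : ℝ) :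
    (n : ℂ) ^ (-(t * I)) = cexp (-(Real.log n) * t * I) := by
  rw [cpow_def_of_ne_zero (by exact_mod_cast hn), ← natCast_log]
  ring_nf

lemma norm_dirichletPoly_le (hs : ∀ n ∈ s, n ≠ 0) (hw : ∀ n ∈ s, 0 ≤ w n) (t : ℝ) :
    ‖dirichletPoly s w t‖ ≤ ∑ n ∈ s, w n := by
  refine norm_sum_le_of_le _ fun n hn ↦ ?_
  rw [norm_mul, norm_real, Real.norm_of_nonneg (hw n hn),
    norm_natCast_cpow_of_pos (Nat.pos_of_ne_zero (hs n hn))]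
  simp

lemma continuous_dirichletPoly (hs : ∀ n ∈ s, n ≠ 0) : Continuous (dirichletPoly s w) := by
  refine continuous_finsetSum _ fun n hn ↦ continuous_const.mul ?_
  simp only [natCast_cpow_neg_mul_I (hs n hn)]
  fun_prop

lemma dirichletPoly_mul_sq_norm_eq_sum (hs : ∀ n ∈ s, n ≠ 0) (hA : ∀ a ∈ A, a ≠ 0) (t : ℝ) :
    dirichletPoly s w t * (‖dirichletPoly A 1 t‖ ^ 2 : ℝ) =
      ∑ p ∈ s ×ˢ A ×ˢ A, (w p.1 : ℂ) *
        cexp ((Real.log p.2.2 - Real.log (p.1 * p.2.1 : ℕ) : ℝ) * t * I) := by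
  rw [← normSq_eq_norm_sq, ← mul_conj, dirichletPoly, dirichletPoly, map_sum, Finset.sum_mul_sum,
    Finset.sum_mul, Finset.sum_product]
  refine Finset.sum_congr rfl fun n hn ↦ ?_
  rw [Finset.sum_product, Finset.mul_sum]
  refine Finset.sum_congr rfl fun a ha ↦ ?_
  rw [Finset.mul_sum]
  refine Finset.sum_congr rfl fun b hb ↦ ?_
  have hn₀ := hs n hn
  have ha₀ := hA a ha
  rw [natCast_cpow_neg_mul_I hn₀, natCast_cpow_neg_mul_I ha₀, natCast_cpow_neg_mul_I (hA b hb),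
    Nat.cast_mul, Real.log_mul (by exact_mod_cast hn₀) (by exact_mod_cast ha₀)]
  simp only [Pi.one_apply, ofReal_one, one_mul, ← exp_conj, map_mul, map_neg, conj_ofReal, conj_I]
  rw [mul_assoc, ← exp_add, ← exp_add]
  congr 2
  push_cast
  ring

lemma resonanceSum_eq_sum (s A : Finset ℕ) (w : ℕ → ℝ) :
    resonanceSum s w A = ∑ p ∈ s ×ˢ A ×ˢ A, if p.1 * p.2.1 = p.2.2 then w p.1 else 0 := by
  simp_rw [resonanceSum, Finset.sum_product, Finset.sum_ite_eq, ← Finset.sum_filter,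
    Finset.sum_const, nsmul_eq_mul, mul_comm]

theorem norm_integral_dirichletPoly_mul_sq_norm_sub_le (hs : ∀ n ∈ s, n ≠ 0)
    (hw : ∀ n ∈ s, 0 ≤ w n) {D : ℕ} (hA : ∀ a ∈ A, a ≠ 0 ∧ a ≤ D) (τ : ℝ) (v : ℝ≥0) :
    ‖∫ t, dirichletPoly s w t * (‖dirichletPoly A 1 t‖ ^ 2 : ℝ) ∂gaussianReal τ v -
        resonanceSum s w A‖ ≤
      Real.exp (-(v / (2 * ((D : ℝ) + 1) ^ 2))) * ((∑ n ∈ s, w n) * A.card ^ 2) := by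
  have hA₀ : ∀ a ∈ A, a ≠ 0 := fun a ha ↦ (hA a ha).1
  have hint : ∀ x : ℝ, Integrable (fun t : ℝ ↦ cexp (x * t * I)) (gaussianReal τ v) := fun x ↦
    .of_bound (by fun_prop) 1 (.of_forall fun t ↦ by
      rw [← ofReal_mul, norm_exp_ofReal_mul_I])
  simp only [dirichletPoly_mul_sq_norm_eq_sum hs hA₀]
  rw [integral_finsetSum _ fun p _ ↦ (hint _).const_mul _, resonanceSum_eq_sum]
  simp only [integral_const_mul, ← charFun_apply_real]
  have hweights : (∑ n ∈ s, w n) * (A.card : ℝ) ^ 2 = ∑ p ∈ s ×ˢ A ×ˢ A, w p.1 := by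
    simp_rw [Finset.sum_product, Finset.sum_const, nsmul_eq_mul, ← Finset.mul_sum]
    ring
  rw [hweights, Finset.mul_sum, ofReal_sum, ← Finset.sum_sub_distrib]
  refine norm_sum_le_of_le _ fun ⟨n, a, b⟩ hp ↦ ?_
  simp only [Finset.mem_product] at hp ⊢
  obtain ⟨hn, ha, hb⟩ := hp
  split_ifs with heq
  · have hwn := hw n hn
    rw [heq, sub_self, charFun_zero, probReal_univ, ofReal_one, mul_one, sub_self, norm_zero]
    positivity
  · rw [ofReal_zero, sub_zero, norm_mul, norm_real, Real.norm_of_nonneg (hw n hn), mul_comm]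
    exact mul_le_mul_of_nonneg_right (norm_charFun_gaussianReal_log_sub_log_le
      (mul_ne_zero (hs n hn) (hA₀ a ha)) (hA₀ b hb) (hA b hb).2 heq τ v) (hw n hn)

lemma integral_sq_norm_dirichletPoly_one_le {D : ℕ} (hA : ∀ a ∈ A, a ≠ 0 ∧ a ≤ D) (τ : ℝ)
    (v : ℝ≥0) :
    ∫ t, ‖dirichletPoly A 1 t‖ ^ 2 ∂gaussianReal τ v ≤
      A.card + Real.exp (-(v / (2 * ((D : ℝ) + 1) ^ 2))) * A.card ^ 2 := by
  -- The constant polynomial `1` turns the resonance integral into the second moment.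
  have h := norm_integral_dirichletPoly_mul_sq_norm_sub_le (s := {1}) (w := 1) (by simp) (by simp)
    hA τ v
  simp only [dirichletPoly, Finset.sum_singleton, Pi.one_apply, ofReal_one, Nat.cast_one, one_cpow,
    one_mul, resonanceSum, Finset.filter_mem_eq_inter, Finset.inter_self] at h
  rw [integral_complex_ofReal, ← ofReal_sub, norm_real, Real.norm_eq_abs] at h
  simpa only [dirichletPoly, Pi.one_apply, ofReal_one, one_mul] using
    sub_le_iff_le_add'.mp ((le_abs_self _).trans h)

lemma sq_norm_dirichletPoly_one_le (hA : ∀ a ∈ A, a ≠ 0) (t : ℝ) :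
    ‖dirichletPoly A 1 t‖ ^ 2 ≤ (A.card : ℝ) ^ 2 := by
  have h := norm_dirichletPoly_le hA (w := 1) (fun _ _ ↦ zero_le_one) t
  simp only [Pi.one_apply, Finset.sum_const, nsmul_eq_mul, mul_one] at h
  gcongr

lemma integrable_sq_norm_dirichletPoly_one (hA : ∀ a ∈ A, a ≠ 0) (μ : Measure ℝ)
    [IsFiniteMeasure μ] : Integrable (fun t ↦ ‖dirichletPoly A 1 t‖ ^ 2) μ :=
  .of_bound ((continuous_dirichletPoly hA).norm.pow 2).aestronglyMeasurable (A.card ^ 2)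
    (.of_forall fun t ↦ by simpa using sq_norm_dirichletPoly_one_le hA t)

lemma norm_integral_dirichletPoly_mul_sq_norm_le (hs : ∀ n ∈ s, n ≠ 0) (hw : ∀ n ∈ s, 0 ≤ w n)
    (hA : ∀ a ∈ A, a ≠ 0) (τ : ℝ) (v : ℝ≥0) {η M : ℝ} (hη : 0 ≤ η) (hM₀ : 0 ≤ M)
    (hM : ∀ t, |t - τ| < η → ‖dirichletPoly s w t‖ ≤ M) :
    ‖∫ t, dirichletPoly s w t * (‖dirichletPoly A 1 t‖ ^ 2 : ℝ) ∂gaussianReal τ v‖ ≤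
      M * ∫ t, ‖dirichletPoly A 1 t‖ ^ 2 ∂gaussianReal τ v +
        2 * Real.exp (-η ^ 2 / (2 * v)) * ((∑ n ∈ s, w n) * A.card ^ 2) := by
  set B := ∑ n ∈ s, w n
  have hB : 0 ≤ B := Finset.sum_nonneg hw
  have hRint := integrable_sq_norm_dirichletPoly_one hA (gaussianReal τ v)
  have hmeas : MeasurableSet {t : ℝ | η ≤ |t - τ|} :=
    measurableSet_le measurable_const (by fun_prop)
  have htail : Integrable ({t : ℝ | η ≤ |t - τ|}.indicator fun _ ↦ B * (A.card : ℝ) ^ 2)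
      (gaussianReal τ v) := (integrable_const _).indicator hmeas
  have hpoint : ∀ t, ‖dirichletPoly s w t * (‖dirichletPoly A 1 t‖ ^ 2 : ℝ)‖ ≤
      M * ‖dirichletPoly A 1 t‖ ^ 2 +
        {t : ℝ | η ≤ |t - τ|}.indicator (fun _ ↦ B * (A.card : ℝ) ^ 2) t := by
    intro t
    rw [norm_mul, norm_real, Real.norm_of_nonneg (sq_nonneg _)]
    by_cases ht : η ≤ |t - τ|
    · rw [Set.indicator_of_mem (show t ∈ {t : ℝ | η ≤ |t - τ|} from ht)]
      exact (mul_le_mul (norm_dirichletPoly_le hs hw t) (sq_norm_dirichletPoly_one_le hA t)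
        (sq_nonneg _) hB).trans (le_add_of_nonneg_left (by positivity))
    · rw [Set.indicator_of_notMem (show t ∉ {t : ℝ | η ≤ |t - τ|} from ht), add_zero]
      gcongr
      exact hM t (not_le.mp ht)
  refine (norm_integral_le_of_norm_le ((hRint.const_mul M).add htail)
    (.of_forall hpoint)).trans ?_
  rw [integral_add' (hRint.const_mul M) htail, integral_const_mul,
    integral_indicator_const _ hmeas, smul_eq_mul]
  gcongr
  exact measureReal_gaussianReal_le_abs_sub τ v hη

theorem resonanceSum_le {D : ℕ} (hs : ∀ n ∈ s, n ≠ 0) (hw : ∀ n ∈ s, 0 ≤ w n)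
    (hA : ∀ a ∈ A, a ≠ 0 ∧ a ≤ D) (τ : ℝ) (v : ℝ≥0) {η M : ℝ} (hη : 0 ≤ η) (hM₀ : 0 ≤ M)
    (hM : ∀ t, |t - τ| < η → ‖dirichletPoly s w t‖ ≤ M) :
    resonanceSum s w A ≤ M * A.card +
      ((M + ∑ n ∈ s, w n) * Real.exp (-(v / (2 * ((D : ℝ) + 1) ^ 2))) +
        2 * (∑ n ∈ s, w n) * Real.exp (-η ^ 2 / (2 * v))) * A.card ^ 2 := by
  set J : ℂ := ∫ t, dirichletPoly s w t * (‖dirichletPoly A 1 t‖ ^ 2 : ℝ) ∂gaussianReal τ v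
  have hdiag : resonanceSum s w A ≤ ‖J‖ + ‖J - resonanceSum s w A‖ := by
    refine (le_abs_self _).trans ?_
    rw [← Real.norm_eq_abs, ← norm_real]
    simpa using norm_sub_le J (J - resonanceSum s w A)
  have hoff := norm_integral_dirichletPoly_mul_sq_norm_sub_le hs hw hA τ v
  have hJ :=
    norm_integral_dirichletPoly_mul_sq_norm_le hs hw (fun a ha ↦ (hA a ha).1) τ v hη hM₀ hM
  have hres := mul_le_mul_of_nonneg_left (integral_sq_norm_dirichletPoly_one_le hA τ v) hM₀
  linarith

lemma card_mul_sum_le_resonanceSum {s' : Finset ℕ} (hs' : s' ⊆ s) (hw : ∀ n ∈ s, 0 ≤ w n) {ρ : ℝ}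
    (hρ : ∀ n ∈ s', A.card * ρ ≤ ({a ∈ A | n * a ∈ A} : Finset ℕ).card) :
    A.card * (ρ * ∑ n ∈ s', w n) ≤ resonanceSum s w A := by
  rw [← mul_assoc, Finset.mul_sum, resonanceSum]
  refine le_trans (Finset.sum_le_sum fun n hn ↦ ?_)
    (Finset.sum_le_sum_of_subset_of_nonneg hs' fun n hn _ ↦
      mul_nonneg (hw n hn) (Nat.cast_nonneg _))
  rw [mul_comm]
  exact mul_le_mul_of_nonneg_left (hρ n hn) (hw n (hs' hn))

lemma sqrt_div_le_div_sq_add_one {T D : ℝ} (hT : 1 ≤ T) (hD : 0 ≤ D) (hDT : D ^ 2 ≤ T) :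
    √T / 16 ≤ T * √T / 2 / (2 * (D + 1) ^ 2) := by
  rw [le_div_iff₀ (by positivity)]
  have hD' : (D + 1) ^ 2 ≤ 4 * T := by nlinarith [sq_nonneg (D - 1)]
  nlinarith [Real.sqrt_nonneg T]

theorem resonanceSum_le_of_sq_le {T : ℝ} (hT : 1 ≤ T) (hs : ∀ n ∈ s, n ≠ 0)
    (hw : ∀ n ∈ s, 0 ≤ w n) {D : ℕ} (hA : ∀ a ∈ A, a ≠ 0 ∧ a ≤ D) (hD : (D : ℝ) ^ 2 ≤ T) {M : ℝ}
    (hM : ∀ t ∈ Set.Icc T (2 * T), ‖dirichletPoly s w t‖ ≤ M) :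
    resonanceSum s w A ≤
      A.card * (M + (M + 3 * ∑ n ∈ s, w n) * (T * Real.exp (-√T / 16))) := by
  have hM₀ : 0 ≤ M := (norm_nonneg _).trans (hM T ⟨le_rfl, by linarith⟩)
  have hB : 0 ≤ ∑ n ∈ s, w n := Finset.sum_nonneg hw
  have hcard : (A.card : ℝ) ≤ T := by
    have hsub : A ⊆ Finset.Icc 1 D := fun a ha ↦
      Finset.mem_Icc.mpr ⟨Nat.pos_of_ne_zero (hA a ha).1, (hA a ha).2⟩
    have hle : (A.card : ℝ) ≤ D := by
      exact_mod_cast (Finset.card_le_card hsub).trans_eq (Nat.card_Icc 1 D)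
    have hDsq : (D : ℝ) ≤ (D : ℝ) ^ 2 := by exact_mod_cast Nat.le_self_pow two_ne_zero D
    linarith
  -- Off-diagonal terms need `v ≥ T ^ (1 + δ)`, the Gaussian tails need `v ≤ T ^ (2 - δ)`.
  set v : ℝ≥0 := ⟨T * √T / 2, by positivity⟩
  have hoff : Real.exp (-(v / (2 * ((D : ℝ) + 1) ^ 2))) ≤ Real.exp (-√T / 16) := by
    rw [Real.exp_le_exp, neg_div, neg_le_neg_iff]
    exact sqrt_div_le_div_sq_add_one hT (Nat.cast_nonneg D) hD
  have htail : Real.exp (-(T / 2) ^ 2 / (2 * v)) ≤ Real.exp (-√T / 16) := by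
    have hv : -(T / 2) ^ 2 / (2 * v) = -√T / 4 := by
      have hsqrt : √T * √T = T := Real.mul_self_sqrt (by linarith)
      have hsqrt₀ : √T ≠ 0 := (Real.sqrt_pos.mpr (by linarith)).ne'
      change -(T / 2) ^ 2 / (2 * (T * √T / 2)) = -√T / 4
      field_simp [hsqrt₀]
      linear_combination 4 * hsqrt
    rw [hv, Real.exp_le_exp]
    linarith [Real.sqrt_nonneg T]
  have h := resonanceSum_le hs hw hA (3 * T / 2) v (η := T / 2) (by linarith) hM₀ fun t ht ↦ by
    rw [abs_lt] at ht
    exact hM t ⟨by linarith, by linarith⟩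
  calc resonanceSum s w A
      ≤ M * A.card + ((M + ∑ n ∈ s, w n) * Real.exp (-√T / 16) +
          2 * (∑ n ∈ s, w n) * Real.exp (-√T / 16)) * (A.card * T) := by
        refine h.trans ?_
        rw [sq (A.card : ℝ)]
        gcongr
    _ = _ := by ring

end Resonance

/-! ### Divisors of powers of primorials -/

lemma one_sub_sum_le_prod_one_sub {ι : Type*} (s : Finset ι) {x : ι → ℝ}
    (hx₀ : ∀ i ∈ s, 0 ≤ x i) (hx₁ : ∀ i ∈ s, x i ≤ 1) :
    1 - ∑ i ∈ s, x i ≤ ∏ i ∈ s, (1 - x i) := by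
  classical
  induction s using Finset.induction_on with
  | empty => simp
  | insert j s hj ih =>
    rw [Finset.forall_mem_insert] at hx₀ hx₁
    have hsum : 0 ≤ ∑ i ∈ s, x i := Finset.sum_nonneg hx₀.2
    rw [Finset.sum_insert hj, Finset.prod_insert hj]
    calc 1 - (x j + ∑ i ∈ s, x i) ≤ (1 - x j) * (1 - ∑ i ∈ s, x i) := by nlinarith [hx₀.1]
      _ ≤ _ := mul_le_mul_of_nonneg_left (ih hx₀.2 hx₁.2) (sub_nonneg.mpr hx₁.1)

lemma filter_mul_mem_divisors_eq_divisors_div {n D : ℕ} (hn : n ≠ 0) (h : n ∣ D) :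
    {a ∈ D.divisors | n * a ∈ D.divisors} = (D / n).divisors := by
  ext a
  rw [Finset.mem_filter, Nat.mem_divisors, Nat.mem_divisors, Nat.mem_divisors,
    Nat.dvd_div_iff_mul_dvd h, Nat.div_ne_zero_iff_of_dvd h]
  exact ⟨fun ha ↦ ⟨ha.2.1, ha.1.2, hn⟩,
    fun ha ↦ ⟨⟨(dvd_mul_left a n).trans ha.1, ha.2.1⟩, ha.1, ha.2.1⟩⟩

lemma card_divisors_mul_one_sub_sum_le_card_divisors_div {n D : ℕ} (hD : D ≠ 0) (h : n ∣ D) :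
    D.divisors.card * (1 - ∑ p ∈ D.primeFactors,
      (n.factorization p : ℝ) / (D.factorization p + 1)) ≤ (D / n).divisors.card := by
  have hn : n ≠ 0 := ne_zero_of_dvd_ne_zero hD h
  have hle := (Nat.factorization_le_iff_dvd hn hD).mpr h
  have hratio : ((D / n).divisors.card : ℝ) = D.divisors.card *
      ∏ p ∈ D.primeFactors, (1 - (n.factorization p : ℝ) / (D.factorization p + 1)) := by
    have hDn : (D / n).divisors.card = ∏ p ∈ D.primeFactors, ((D / n).factorization p + 1) := by
      rw [Nat.card_divisors (Nat.div_ne_zero_iff_of_dvd h |>.mpr ⟨hD, hn⟩)]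
      refine Finset.prod_subset (Nat.primeFactors_mono (Nat.div_dvd_of_dvd h) hD) fun p _ hp ↦ ?_
      rw [← Nat.support_factorization, Finsupp.notMem_support_iff] at hp
      rw [hp, zero_add]
    rw [hDn, Nat.card_divisors hD, Nat.cast_prod, Nat.cast_prod, ← Finset.prod_mul_distrib]
    refine Finset.prod_congr rfl fun p _ ↦ ?_
    rw [Nat.factorization_div h, Finsupp.tsub_apply]
    push_cast [hle p]
    field_simp
    ring
  rw [hratio]
  refine mul_le_mul_of_nonneg_left (one_sub_sum_le_prod_one_sub _ (fun p _ ↦ by positivity)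
    fun p _ ↦ ?_) (Nat.cast_nonneg _)
  rw [div_le_one (by positivity)]
  exact_mod_cast (hle p).trans (Nat.le_succ _)

lemma le_factorization_primorial_pow {p Y : ℕ} (hp : p.Prime) (hpY : p ≤ Y) (E : ℕ) :
    E ≤ (primorial Y ^ E).factorization p :=
  (hp.pow_dvd_iff_le_factorization (pow_ne_zero E (primorial_ne_zero Y))).mp
    (pow_dvd_pow_of_dvd (hp.dvd_primorial_iff.mpr hpY) E)

lemma factorization_le_cardFactors (n p : ℕ) : n.factorization p ≤ Ω n := by
  rw [ArithmeticFunction.cardFactors_eq_sum_factorization]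
  by_cases hp : p ∈ n.factorization.support
  · exact Finset.single_le_sum (f := n.factorization) (fun _ _ ↦ Nat.zero_le _) hp
  · rw [Finsupp.notMem_support_iff.mp hp]
    exact Nat.zero_le _

lemma dvd_primorial_pow {n Y E : ℕ} (hn : n ≠ 0) (hnY : n ≤ Y) (hE : Ω n ≤ E) :
    n ∣ primorial Y ^ E := by
  refine (Nat.factorization_prime_le_iff_dvd hn
    (pow_ne_zero E (primorial_ne_zero Y))).mp fun p hp ↦ ?_
  by_cases hpn : p ∣ n
  · exact (factorization_le_cardFactors n p).trans (hE.trans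
      (le_factorization_primorial_pow hp ((Nat.le_of_dvd (Nat.pos_of_ne_zero hn) hpn).trans hnY) E))
  · rw [Nat.factorization_eq_zero_of_not_dvd hpn]
    exact Nat.zero_le _

theorem card_divisors_primorial_pow_mul_one_sub_le {n Y : ℕ} (hn : n ≠ 0) (hnY : n ≤ Y) (E : ℕ) :
    ((primorial Y ^ E).divisors.card : ℝ) * (1 - Ω n / (E + 1)) ≤
      ({a ∈ (primorial Y ^ E).divisors | n * a ∈ (primorial Y ^ E).divisors} : Finset ℕ).card := by
  rcases lt_or_ge E (Ω n) with hE | hE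
  · have h : (1 : ℝ) ≤ Ω n / (E + 1) := by
      rw [one_le_div (by positivity)]
      exact_mod_cast hE
    exact (mul_nonpos_of_nonneg_of_nonpos (Nat.cast_nonneg _) (sub_nonpos.mpr h)).trans
      (Nat.cast_nonneg _)
  have hD : primorial Y ^ E ≠ 0 := pow_ne_zero E (primorial_ne_zero Y)
  have hdvd := dvd_primorial_pow hn hnY hE
  rw [filter_mul_mem_divisors_eq_divisors_div hn hdvd]
  refine le_trans ?_ (card_divisors_mul_one_sub_sum_le_card_divisors_div hD hdvd)
  gcongr
  rw [ArithmeticFunction.cardFactors_eq_sum_factorization, Finsupp.sum, Nat.cast_sum,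
    Finset.sum_div, Nat.support_factorization]
  rw [← Finset.sum_subset (Nat.primeFactors_mono hdvd hD) fun p _ hp ↦ by
    rw [← Nat.support_factorization, Finsupp.notMem_support_iff] at hp
    rw [hp, Nat.cast_zero, zero_div]]
  gcongr with p hp
  exact le_factorization_primorial_pow (Nat.prime_of_mem_primeFactors hp)
    ((Nat.le_of_mem_primeFactors hp).trans hnY) E

lemma cardFactors_mul_log_two_le {n : ℕ} (hn : n ≠ 0) : Ω n * Real.log 2 ≤ Real.log n := by
  have h : 2 ^ Ω n ≤ n := by
    rw [ArithmeticFunction.cardFactors_apply]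
    exact (List.pow_card_le_prod _ 2 fun p hp ↦
      (Nat.prime_of_mem_primeFactorsList hp).two_le).trans_eq (Nat.prod_primeFactorsList hn)
  rw [← Real.log_pow]
  exact Real.log_le_log (by positivity) (by exact_mod_cast h)

lemma primorial_pow_le_four_pow (Y E : ℕ) : primorial Y ^ E ≤ 4 ^ (Y * E) := by
  rw [pow_mul]
  exact Nat.pow_le_pow_left (primorial_le_four_pow Y) E

/-! ### Sums of `(log n) ^ l / n` -/

lemma log_add_one_pow_sub_log_pow_le {x : ℝ} (hx : 1 ≤ x) (l : ℕ) :
    (1 - 1 / (x + 1)) * ((Real.log (x + 1) ^ (l + 1) - Real.log x ^ (l + 1)) / (l + 1)) ≤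
      Real.log (x + 1) ^ l / (x + 1) := by
  have hx₀ : 0 < x := by linarith
  have ha : 0 ≤ Real.log x := Real.log_nonneg hx
  have hab : Real.log x ≤ Real.log (x + 1) := Real.log_le_log hx₀ (by linarith)
  have hb : 0 ≤ Real.log (x + 1) := ha.trans hab
  have hba : Real.log (x + 1) - Real.log x ≤ 1 / x := by
    rw [← Real.log_div (by positivity) hx₀.ne']
    refine (Real.log_le_sub_one_of_pos (by positivity)).trans_eq ?_
    field_simp
    ring
  have hpow : Real.log (x + 1) ^ (l + 1) - Real.log x ^ (l + 1) ≤
      1 / x * (l + 1) * Real.log (x + 1) ^ l := by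
    have h := (le_abs_self _).trans (abs_pow_sub_pow_le (Real.log (x + 1)) (Real.log x) (l + 1))
    rw [abs_of_nonneg (sub_nonneg.mpr hab), abs_of_nonneg ha, abs_of_nonneg hb,
      max_eq_left hab, Nat.add_sub_cancel, Nat.cast_add_one] at h
    exact h.trans (by gcongr)
  calc _ ≤ x / (x + 1) * ((1 / x * (l + 1) * Real.log (x + 1) ^ l) / (l + 1)) := by
        rw [one_sub_div (by positivity), add_sub_cancel_right]
        gcongr
    _ = _ := by field_simp

theorem log_pow_sub_log_pow_le_sum (l : ℕ) {m Y : ℕ} (hm : m ≠ 0) (hmY : m ≤ Y) :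
    (1 - 1 / ((m : ℝ) + 1)) * ((Real.log Y ^ (l + 1) - Real.log m ^ (l + 1)) / (l + 1)) ≤
      ∑ n ∈ Finset.Ioc m Y, Real.log n ^ l / n := by
  induction Y, hmY using Nat.le_induction with
  | base => simp
  | succ Y hY ih =>
    have hY₁ : (1 : ℝ) ≤ Y := by exact_mod_cast (Nat.pos_of_ne_zero hm).trans_le hY
    have hmono : Real.log Y ≤ Real.log (Y + 1) := Real.log_le_log (by linarith) (by linarith)
    have hinc : 0 ≤ (Real.log (Y + 1) ^ (l + 1) - Real.log Y ^ (l + 1)) / (l + 1) :=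
      div_nonneg (sub_nonneg.mpr (pow_le_pow_left₀ (Real.log_natCast_nonneg Y) hmono _))
        (by positivity)
    have hmY : 1 - 1 / ((m : ℝ) + 1) ≤ 1 - 1 / ((Y : ℝ) + 1) := by gcongr
    have hstep := (mul_le_mul_of_nonneg_right hmY hinc).trans
      (log_add_one_pow_sub_log_pow_le hY₁ l)
    rw [Finset.sum_Ioc_succ_top hY]
    push_cast
    linear_combination ih + hstep

/-! ### The derivatives of `ζ` as Dirichlet polynomials -/

/-- The coefficient of `n ^ (-it)` in the Dirichlet series of `(-1) ^ l * ζ^(l) (1 + it)`. -/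
noncomputable def zetaWeight (l n : ℕ) : ℝ :=
  Real.log n ^ l / n

lemma zetaWeight_nonneg (l n : ℕ) : 0 ≤ zetaWeight l n :=
  div_nonneg (pow_nonneg (Real.log_natCast_nonneg n) l) (Nat.cast_nonneg n)

lemma dirichletPoly_zetaWeight (X l : ℕ) (t : ℝ) :
    dirichletPoly (Finset.Icc 1 X) (zetaWeight l) t =
      ∑ n ∈ Finset.Icc 1 X, (Real.log n : ℂ) ^ l * (n : ℂ) ^ (-(1 + t * I)) := by
  refine Finset.sum_congr rfl fun n hn ↦ ?_
  have hn₀ : (n : ℂ) ≠ 0 := by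
    exact_mod_cast Nat.one_le_iff_ne_zero.mp (Finset.mem_Icc.mp hn).1
  rw [zetaWeight, neg_add, cpow_add _ _ hn₀, cpow_neg_one]
  push_cast
  ring

lemma pow_le_of_le_log_div_log {x T : ℝ} {l : ℕ} (hx : 1 < x) (hT : 0 < T)
    (hl : (l : ℝ) ≤ Real.log T / Real.log x) : x ^ l ≤ T := by
  rw [← Real.log_le_log_iff (by positivity) hT, Real.log_pow]
  exact (le_div_iff₀ (Real.log_pos hx)).mp hl

section LargeParameter

variable {T : ℝ} (hT : Real.exp (Real.exp 2) ≤ T)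
include hT

lemma pos_of_exp_exp_two_le : 0 < T := (Real.exp_pos _).trans_le hT

lemma exp_two_le_log : Real.exp 2 ≤ Real.log T :=
  (Real.le_log_iff_exp_le (pos_of_exp_exp_two_le hT)).mpr hT

lemma three_le_log : 3 ≤ Real.log T := by
  linarith [exp_two_le_log hT, Real.add_one_le_exp (2 : ℝ)]

lemma two_le_log_log : 2 ≤ Real.log (Real.log T) :=
  (Real.le_log_iff_exp_le (by linarith [three_le_log hT])).mpr (exp_two_le_log hT)

lemma log_add_one_le_self : Real.log T + 1 ≤ T := by
  linarith [Real.log_le_sub_one_of_pos (pos_of_exp_exp_two_le hT)]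

lemma log_ceil_sq_mem_Icc :
    Real.log ⌈T ^ 2⌉₊ ∈ Set.Icc (2 * Real.log T) (3 * Real.log T) := by
  have hT₄ : 4 ≤ T := by linarith [log_add_one_le_self hT, three_le_log hT]
  have hle : T ^ 2 ≤ (⌈T ^ 2⌉₊ : ℝ) := Nat.le_ceil _
  have hlt := Nat.ceil_lt_add_one (sq_nonneg T)
  constructor
  · have h := Real.log_le_log (by positivity) hle
    rwa [Real.log_pow, Nat.cast_ofNat] at h
  · have h := Real.log_le_log (y := T ^ 3) ((by positivity : 0 < T ^ 2).trans_le hle)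
      (by nlinarith)
    rwa [Real.log_pow, Nat.cast_ofNat] at h

variable {l : ℕ} (hl : (l : ℝ) ≤ Real.log T / Real.log (Real.log T))
include hl

lemma log_pow_le_self : Real.log T ^ l ≤ T :=
  pow_le_of_le_log_div_log (by linarith [three_le_log hT]) (pos_of_exp_exp_two_le hT) hl

lemma add_one_le_log : (l : ℝ) + 1 ≤ Real.log T := by
  have hlog₃ := three_le_log hT
  have hhalf : (l : ℝ) ≤ Real.log T / 2 := hl.trans (by gcongr; exact two_le_log_log hT)
  linarith

lemma exp_mul_log_ceil_sq_pow_mul_le :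
    Real.exp (l + 1) * Real.log ⌈T ^ 2⌉₊ ^ l * (14 / T) ≤ 126 ^ (l + 1) := by
  have hT₀ := pos_of_exp_exp_two_le hT
  have hlog₃ := three_le_log hT
  have hlogX := log_ceil_sq_mem_Icc hT
  have hexp : Real.exp (l + 1) ≤ 3 ^ (l + 1) := by
    rw [← Nat.cast_add_one, ← Real.exp_one_pow]
    gcongr
    exact Real.exp_one_lt_three.le
  have hpow : Real.log ⌈T ^ 2⌉₊ ^ l ≤ 3 ^ l * T := by
    calc Real.log ⌈T ^ 2⌉₊ ^ l ≤ (3 * Real.log T) ^ l :=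
          pow_le_pow_left₀ (by linarith [hlogX.1]) hlogX.2 l
      _ ≤ 3 ^ l * T := by rw [mul_pow]; gcongr; exact log_pow_le_self hT hl
  calc _ ≤ 3 ^ (l + 1) * (3 ^ l * T) * (14 / T) := by gcongr
    _ = 14 * 3 * 9 ^ l := by
      rw [show (9 : ℝ) = 3 * 3 by norm_num, mul_pow]; field_simp; ring
    _ ≤ 126 * 126 ^ l := by gcongr <;> norm_num
    _ = 126 ^ (l + 1) := by ring

lemma norm_dirichletPoly_zetaWeight_le {t : ℝ} (ht : t ∈ Set.Icc T (2 * T)) :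
    ‖dirichletPoly (Finset.Icc 1 ⌈T ^ 2⌉₊) (zetaWeight l) t‖ ≤
      ‖iteratedDeriv l riemannZeta (1 + t * I)‖ + 126 ^ (l + 1) := by
  set X := ⌈T ^ 2⌉₊
  have hT₀ := pos_of_exp_exp_two_le hT
  have hlog₃ := three_le_log hT
  have hX : T ^ 2 ≤ X := Nat.le_ceil _
  have hlogX : Real.log X ∈ Set.Icc (2 * Real.log T) (3 * Real.log T) := log_ceil_sq_mem_Icc hT
  have herr : 2 / t + 6 * t / X ≤ 14 / T := by
    calc 2 / t + 6 * t / X ≤ 2 / T + 6 * (2 * T) / T ^ 2 := by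
          gcongr
          · exact ht.1
          · exact ht.2
      _ = 14 / T := by field_simp; norm_num
  have happrox := norm_iteratedDeriv_riemannZeta_sub_sum_le (t := t) (l := l) (X := X)
    (by linarith [ht.1, log_add_one_le_self hT]) (by linarith [hlogX.1, add_one_le_log hT hl])
  rw [← dirichletPoly_zetaWeight] at happrox
  have hbound := (mul_le_mul_of_nonneg_left herr (mul_nonneg (Real.exp_nonneg _)
    (pow_nonneg (Real.log_natCast_nonneg X) l))).trans (exp_mul_log_ceil_sq_pow_mul_le hT hl)
  set P := dirichletPoly (Finset.Icc 1 X) (zetaWeight l) t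
  calc ‖P‖ = ‖(-1) ^ l * P‖ := by rw [norm_mul, norm_pow, norm_neg, norm_one, one_pow, one_mul]
    _ ≤ _ := norm_le_norm_add_norm_sub _ _
    _ ≤ _ := add_le_add_right (happrox.trans hbound) _

lemma sum_zetaWeight_le : ∑ n ∈ Finset.Icc 1 ⌈T ^ 2⌉₊, zetaWeight l n ≤ 2 * T ^ 4 := by
  set X := ⌈T ^ 2⌉₊
  have hlog₃ := three_le_log hT
  have hT₁ : 1 ≤ T := by linarith [log_add_one_le_self hT]
  have hX : (X : ℝ) ≤ 2 * T ^ 2 := by nlinarith [Nat.ceil_lt_add_one (sq_nonneg T)]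
  have hlogX : Real.log X ∈ Set.Icc (2 * Real.log T) (3 * Real.log T) := log_ceil_sq_mem_Icc hT
  have hterm : ∀ n ∈ Finset.Icc 1 X, zetaWeight l n ≤ T ^ 2 := by
    intro n hn
    obtain ⟨hn₁, hnX⟩ := Finset.mem_Icc.mp hn
    have hlogn : Real.log n ≤ 3 * Real.log T :=
      (Real.log_le_log (by exact_mod_cast hn₁) (by exact_mod_cast hnX)).trans hlogX.2
    calc zetaWeight l n ≤ Real.log n ^ l :=
          div_le_self (pow_nonneg (Real.log_natCast_nonneg n) l) (by exact_mod_cast hn₁)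
      _ ≤ (Real.log T * Real.log T) ^ l :=
          pow_le_pow_left₀ (Real.log_natCast_nonneg n) (by nlinarith) l
      _ ≤ T ^ 2 := by
        rw [mul_pow, ← sq]
        exact pow_le_pow_left₀ (by positivity) (log_pow_le_self hT hl) 2
  calc _ ≤ X * T ^ 2 := by simpa using Finset.sum_le_card_nsmul _ _ _ hterm
    _ ≤ 2 * T ^ 2 * T ^ 2 := by gcongr
    _ = 2 * T ^ 4 := by ring

end LargeParameter

/-! ### The resonator -/

/-- The exponent `E` of the resonator modulus, large enough that `Ω n ≤ ε * (E + 1)` for all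
positive `n` up to the cutoff. -/
noncomputable def resonatorExponent (ε T : ℝ) : ℕ :=
  ⌊2 / ε * Real.log (Real.log T)⌋₊

/-- The bound `Y` on the primes in the resonator modulus `D`, which is also the length of the main
term. Up to a constant it is as large as `D ^ 2 ≤ T` permits. -/
noncomputable def resonatorCutoff (ε T : ℝ) : ℕ :=
  ⌊ε * Real.log T / (6 * Real.log (Real.log T))⌋₊

/-- The integer `D` whose divisors are the frequencies of the resonator: the product of the primes
up to the cutoff, raised to the power `resonatorExponent ε T`. -/
noncomputable def resonatorModulus (ε T : ℝ) : ℕ :=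
  primorial (resonatorCutoff ε T) ^ resonatorExponent ε T

lemma resonatorModulus_ne_zero (ε T : ℝ) : resonatorModulus ε T ≠ 0 :=
  pow_ne_zero _ (primorial_ne_zero _)

section Resonator

variable {ε T : ℝ} (hε : 0 < ε) (hT : Real.exp (Real.exp 2) ≤ T)
include hε hT

lemma sq_resonatorModulus_le : (resonatorModulus ε T : ℝ) ^ 2 ≤ T := by
  set Y := resonatorCutoff ε T
  set E := resonatorExponent ε T
  have hlog₃ := three_le_log hT
  have hloglog := two_le_log_log hT
  have hYE : (Y * E : ℝ) ≤ Real.log T / 3 := by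
    calc (Y * E : ℝ) ≤ ε * Real.log T / (6 * Real.log (Real.log T)) *
          (2 / ε * Real.log (Real.log T)) := by
          gcongr <;> exact Nat.floor_le (by positivity)
      _ = Real.log T / 3 := by field_simp; norm_num
  have hlog₂ := Real.log_two_lt_d9
  have hD : (resonatorModulus ε T : ℝ) ≤ 4 ^ (Y * E) := by
    exact_mod_cast primorial_pow_le_four_pow Y E
  refine (pow_le_pow_left₀ (Nat.cast_nonneg _) hD 2).trans ?_
  rw [← Real.log_le_log_iff (by positivity) (pos_of_exp_exp_two_le hT), Real.log_pow, Real.log_pow,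
    show (4 : ℝ) = 2 ^ 2 by norm_num, Real.log_pow]
  push_cast
  have hYE₀ : (0 : ℝ) ≤ Y * E := by positivity
  nlinarith

lemma resonatorCutoff_le_log (hε₁ : ε ≤ 1) : (resonatorCutoff ε T : ℝ) ≤ Real.log T := by
  have hlog₃ := three_le_log hT
  have hloglog := two_le_log_log hT
  refine (Nat.floor_le (by positivity)).trans ?_
  rw [div_le_iff₀ (by positivity)]
  nlinarith

lemma cardFactors_div_resonatorExponent_le (hε₁ : ε ≤ 1) {n : ℕ} (hn : n ≠ 0)
    (hnY : n ≤ resonatorCutoff ε T) : (Ω n : ℝ) / (resonatorExponent ε T + 1) ≤ ε := by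
  have hn_log : (n : ℝ) ≤ Real.log T :=
    (Nat.cast_le.mpr hnY).trans (resonatorCutoff_le_log hε hT hε₁)
  have hΩ : (Ω n : ℝ) * Real.log 2 ≤ Real.log (Real.log T) :=
    (cardFactors_mul_log_two_le hn).trans (Real.log_le_log (by positivity) hn_log)
  have hlog₂ := Real.log_two_gt_d9
  have hΩ₂ : (Ω n : ℝ) ≤ 2 * Real.log (Real.log T) := by
    nlinarith [Nat.cast_nonneg (α := ℝ) (Ω n)]
  have hE : 2 / ε * Real.log (Real.log T) ≤ resonatorExponent ε T + 1 := (Nat.lt_floor_add_one _).le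
  rw [div_le_iff₀ (by positivity)]
  calc (Ω n : ℝ) ≤ ε * (2 / ε * Real.log (Real.log T)) := by
        rwa [← mul_assoc, mul_div_cancel₀ _ hε.ne']
    _ ≤ _ := by gcongr

lemma log_log_sub_le_log_resonatorCutoff
    (hL : 0 ≤ Real.log (Real.log T) - Real.log (Real.log (Real.log T)) - Real.log (12 / ε)) :
    Real.log (Real.log T) - Real.log (Real.log (Real.log T)) - Real.log (12 / ε) ≤
      Real.log (resonatorCutoff ε T) := by
  have hlog₃ := three_le_log hT
  have hloglog := two_le_log_log hT
  set x := ε * Real.log T / (6 * Real.log (Real.log T)) with hx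
  have hlogx : Real.log (x / 2) =
      Real.log (Real.log T) - Real.log (Real.log (Real.log T)) - Real.log (12 / ε) := by
    rw [← Real.log_div (by positivity) (by positivity), ← Real.log_div (by positivity)
      (by positivity), hx]
    congr 1
    field_simp
    norm_num
  have hx₂ : 1 ≤ x / 2 := by
    rwa [← hlogx, Real.log_nonneg_iff (by positivity)] at hL
  rw [← hlogx]
  have hfloor : x / 2 ≤ resonatorCutoff ε T := by
    have h : x < resonatorCutoff ε T + 1 := Nat.lt_floor_add_one x
    linarith
  exact Real.log_le_log (by positivity) hfloor

lemma le_resonanceSum_zetaWeight (hε₁ : ε ≤ 1) (l : ℕ) {m X : ℕ} (hm : 1 / ε ≤ m)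
    (hmY : m ≤ resonatorCutoff ε T) (hYX : resonatorCutoff ε T ≤ X) :
    (resonatorModulus ε T).divisors.card * ((1 - ε) ^ 2 *
        ((Real.log (resonatorCutoff ε T) ^ (l + 1) - Real.log m ^ (l + 1)) / (l + 1))) ≤
      resonanceSum (Finset.Icc 1 X) (zetaWeight l) (resonatorModulus ε T).divisors := by
  set Y := resonatorCutoff ε T
  have hm₀ : (0 : ℝ) < m := (by positivity : 0 < 1 / ε).trans_le hm
  have hdivisors : ∀ n ∈ Finset.Ioc m Y, (resonatorModulus ε T).divisors.card * (1 - ε) ≤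
      (({a ∈ (resonatorModulus ε T).divisors | n * a ∈ (resonatorModulus ε T).divisors} :
        Finset ℕ).card : ℝ) := by
    intro n hn
    rw [Finset.mem_Ioc] at hn
    refine le_trans ?_ (card_divisors_primorial_pow_mul_one_sub_le (by omega) hn.2 _)
    exact mul_le_mul_of_nonneg_left (sub_le_sub_left
      (cardFactors_div_resonatorExponent_le hε hT hε₁ (by omega) hn.2) 1) (Nat.cast_nonneg _)
  have hsub : Finset.Ioc m Y ⊆ Finset.Icc 1 X := fun n hn ↦ by
    rw [Finset.mem_Ioc] at hn
    exact Finset.mem_Icc.mpr ⟨by omega, hn.2.trans hYX⟩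
  have hinv : 1 - ε ≤ 1 - 1 / ((m : ℝ) + 1) := by
    rw [sub_le_sub_iff_left, one_div_le (by positivity) hε]
    linarith
  have hlog : 0 ≤ (Real.log Y ^ (l + 1) - Real.log m ^ (l + 1)) / (l + 1) := by
    refine div_nonneg (sub_nonneg.mpr ?_) (by positivity)
    gcongr
  refine le_trans ?_
    (card_mul_sum_le_resonanceSum hsub (fun n _ ↦ zetaWeight_nonneg l n) hdivisors)
  rw [sq, mul_assoc (1 - ε)]
  have hε₁' : 0 ≤ 1 - ε := sub_nonneg.mpr hε₁
  gcongr
  exact (mul_le_mul_of_nonneg_right hinv hlog).trans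
    (log_pow_sub_log_pow_le_sum l (by exact_mod_cast hm₀.ne') hmY)

end Resonator

lemma mul_three_mul_pow_le {k : ℕ} (hk : k ≠ 0) : (k : ℝ) * (3 * 126 ^ k) ≤ 756 ^ k := by
  have h₂ : (k : ℝ) ≤ 2 ^ k := by exact_mod_cast Nat.lt_two_pow_self.le
  have h₃ : (3 : ℝ) ≤ 3 ^ k := le_self_pow₀ (by norm_num) hk
  calc (k : ℝ) * (3 * 126 ^ k) ≤ 2 ^ k * (3 ^ k * 126 ^ k) := by gcongr
    _ = 756 ^ k := by rw [← mul_pow, ← mul_pow]; norm_num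

lemma one_sub_four_mul_div_mul_pow_le {ε L a M : ℝ} {k : ℕ} (hε : 0 < ε) (hε₁ : ε ≤ 1) (hk : k ≠ 0)
    (ha : 0 ≤ a) (hL : a + 756 ≤ ε * L)
    (h : (1 - ε) ^ 2 * ((L ^ k - a ^ k) / k) ≤ (M + 126 ^ k) * (1 + ε) + ε) :
    (1 - 4 * ε) / k * L ^ k ≤ M := by
  have hk₀ : (0 : ℝ) < k := by positivity
  have hL₀ : 0 ≤ L := nonneg_of_mul_nonneg_right (by linarith) hε
  have hsmall : a ^ k + k * (3 * 126 ^ k) ≤ ε * L ^ k := by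
    calc a ^ k + k * (3 * 126 ^ k) ≤ a ^ k + 756 ^ k := by gcongr; exact mul_three_mul_pow_le hk
      _ ≤ (a + 756) ^ k := pow_add_pow_le ha (by norm_num) hk
      _ ≤ (ε * L) ^ k := by gcongr
      _ = ε ^ k * L ^ k := mul_pow ..
      _ ≤ ε * L ^ k := by gcongr; exact pow_le_of_le_one hε.le hε₁ hk
  have h126 : (1 : ℝ) ≤ 126 ^ k := one_le_pow₀ (by norm_num)
  have hLk : 0 ≤ L ^ k := by positivity
  rw [mul_div_assoc', div_le_iff₀ hk₀] at h
  rw [div_mul_eq_mul_div, div_le_iff₀ hk₀]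
  have herr : (126 ^ k * (1 + ε) + ε) * k ≤ k * (3 * 126 ^ k) := by
    rw [mul_comm]
    gcongr
    nlinarith
  have hak : (1 - ε) ^ 2 * a ^ k ≤ a ^ k :=
    mul_le_of_le_one_left (by positivity) (pow_le_one₀ (by linarith) (by linarith))
  have hmain : (1 - 4 * ε) * L ^ k * (1 + ε) ≤ M * k * (1 + ε) := by
    nlinarith [mul_nonneg (sq_nonneg ε) hLk]
  exact le_of_mul_le_mul_right hmain (by linarith)

/-! ### Large values -/

lemma add_mul_exp_neg_sqrt_le {ε T B M : ℝ} (hT : 1 ≤ T) (hB : B ≤ 2 * T ^ 4) (hM : 0 ≤ M)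
    (hδ : 6 * T ^ 5 * Real.exp (-√T / 16) ≤ ε) :
    M + (M + 3 * B) * (T * Real.exp (-√T / 16)) ≤ M * (1 + ε) + ε := by
  have hTδ : T * Real.exp (-√T / 16) ≤ ε := by
    refine le_trans ?_ hδ
    gcongr
    calc T ≤ T ^ 5 := le_self_pow₀ hT (by norm_num)
      _ ≤ 6 * T ^ 5 := le_mul_of_one_le_left (by positivity) (by norm_num)
  have hBδ : 3 * B * (T * Real.exp (-√T / 16)) ≤ ε := by
    calc 3 * B * (T * Real.exp (-√T / 16)) ≤ 3 * (2 * T ^ 4) * (T * Real.exp (-√T / 16)) := by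
          gcongr
      _ = 6 * T ^ 5 * Real.exp (-√T / 16) := by ring
      _ ≤ ε := hδ
  linear_combination M * hTδ + hBδ

lemma le_add_mul_of_forall_norm_iteratedDeriv_riemannZeta_le {ε T M : ℝ} {l m : ℕ} (hε : 0 < ε)
    (hε₁ : ε ≤ 1) (hT : Real.exp (Real.exp 2) ≤ T)
    (hl : (l : ℝ) ≤ Real.log T / Real.log (Real.log T))
    (hδ : 6 * T ^ 5 * Real.exp (-√T / 16) ≤ ε) (hm : 1 / ε ≤ m) (hmY : m ≤ resonatorCutoff ε T)
    (hM : ∀ t ∈ Set.Icc T (2 * T), ‖iteratedDeriv l riemannZeta (1 + t * I)‖ ≤ M) :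
    (1 - ε) ^ 2 *
        ((Real.log (resonatorCutoff ε T) ^ (l + 1) - Real.log m ^ (l + 1)) / (l + 1)) ≤
      (M + 126 ^ (l + 1)) * (1 + ε) + ε := by
  have hT₁ : 1 ≤ T := by linarith [log_add_one_le_self hT, three_le_log hT]
  have hM₀ : 0 ≤ M := (norm_nonneg _).trans (hM T ⟨le_rfl, by linarith⟩)
  have hYX : resonatorCutoff ε T ≤ ⌈T ^ 2⌉₊ := by
    have hX : T ^ 2 ≤ (⌈T ^ 2⌉₊ : ℝ) := Nat.le_ceil _
    have hY := resonatorCutoff_le_log hε hT hε₁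
    have hlogT := log_add_one_le_self hT
    exact_mod_cast (by nlinarith : (resonatorCutoff ε T : ℝ) ≤ ⌈T ^ 2⌉₊)
  have hupper := resonanceSum_le_of_sq_le (s := Finset.Icc 1 ⌈T ^ 2⌉₊) (w := zetaWeight l)
    (A := (resonatorModulus ε T).divisors) hT₁
    (fun n hn ↦ Nat.one_le_iff_ne_zero.mp (Finset.mem_Icc.mp hn).1)
    (fun n _ ↦ zetaWeight_nonneg l n)
    (fun a ha ↦ ⟨(Nat.pos_of_mem_divisors ha).ne', Nat.divisor_le ha⟩)
    (sq_resonatorModulus_le hε hT)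
    fun t ht ↦ (norm_dirichletPoly_zetaWeight_le hT hl ht).trans (add_le_add_left (hM t ht) _)
  have hcard : (0 : ℝ) < (resonatorModulus ε T).divisors.card := by
    exact_mod_cast Finset.card_pos.mpr (Nat.nonempty_divisors.mpr (resonatorModulus_ne_zero ε T))
  exact (le_of_mul_le_mul_left ((le_resonanceSum_zetaWeight hε hT hε₁ l hm hmY hYX).trans hupper)
    hcard).trans (add_mul_exp_neg_sqrt_le hT₁ (sum_zetaWeight_le hT hl) (by positivity) hδ)

theorem le_of_forall_norm_iteratedDeriv_riemannZeta_le {ε T M : ℝ} {l : ℕ} (hε : 0 < ε)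
    (hε₁ : ε ≤ 1) (hT : Real.exp (Real.exp 2) ≤ T)
    (hl : (l : ℝ) ≤ Real.log T / Real.log (Real.log T))
    (hL : Real.log ⌈1 / ε⌉₊ + 756 ≤
      ε * (Real.log (Real.log T) - Real.log (Real.log (Real.log T)) - Real.log (12 / ε)))
    (hδ : 6 * T ^ 5 * Real.exp (-√T / 16) ≤ ε)
    (hM : ∀ t ∈ Set.Icc T (2 * T), ‖iteratedDeriv l riemannZeta (1 + t * I)‖ ≤ M) :
    (1 - 4 * ε) / (l + 1) *
        (Real.log (Real.log T) - Real.log (Real.log (Real.log T)) - Real.log (12 / ε)) ^ (l + 1) ≤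
      M := by
  have hlogY := log_log_sub_le_log_resonatorCutoff hε hT
  set L := Real.log (Real.log T) - Real.log (Real.log (Real.log T)) - Real.log (12 / ε)
  have hlogm : 0 ≤ Real.log ⌈1 / ε⌉₊ := Real.log_natCast_nonneg _
  have hL₀ : 0 ≤ L := nonneg_of_mul_nonneg_right (by linarith) hε
  have hLm : Real.log ⌈1 / ε⌉₊ + 756 ≤ L := hL.trans (mul_le_of_le_one_left hL₀ hε₁)
  have hmY : ⌈1 / ε⌉₊ ≤ resonatorCutoff ε T := by
    have hm : (0 : ℝ) < ⌈1 / ε⌉₊ := (by positivity : 0 < 1 / ε).trans_le (Nat.le_ceil _)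
    have hY : (0 : ℝ) < resonatorCutoff ε T := by
      refine Nat.cast_pos.mpr (Nat.pos_of_ne_zero fun h ↦ ?_)
      rw [h, Nat.cast_zero, Real.log_zero] at hlogY
      linarith [hlogY hL₀]
    exact_mod_cast (Real.log_le_log_iff hm hY).mp (by linarith [hlogY hL₀])
  have hres := le_add_mul_of_forall_norm_iteratedDeriv_riemannZeta_le hε hε₁ hT hl hδ
    (Nat.le_ceil _) hmY hM
  rw [← Nat.cast_add_one] at hres ⊢
  refine one_sub_four_mul_div_mul_pow_le hε hε₁ l.succ_ne_zero hlogm hL (le_trans ?_ hres)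
  gcongr
  exact hlogY hL₀

lemma tendsto_sub_log_atTop : Tendsto (fun x : ℝ ↦ x - Real.log x) atTop atTop :=
  (Asymptotics.IsEquivalent.refl.sub_isLittleO Real.isLittleO_log_id_atTop).symm.tendsto_atTop
    tendsto_id

lemma tendsto_pow_mul_exp_neg_sqrt_atTop (n : ℕ) {b : ℝ} (hb : 0 < b) :
    Tendsto (fun T : ℝ ↦ T ^ n * Real.exp (-√T / b)) atTop (𝓝 0) := by
  have hsqrt : Tendsto (fun T : ℝ ↦ √T / b) atTop atTop :=
    Real.tendsto_sqrt_atTop.atTop_div_const hb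
  have h := ((Real.tendsto_pow_mul_exp_neg_atTop_nhds_zero (2 * n)).comp hsqrt).const_mul
    (b ^ (2 * n))
  rw [mul_zero] at h
  refine h.congr' ?_
  filter_upwards [eventually_ge_atTop 0] with T hT
  rw [Function.comp_apply, ← mul_assoc, ← mul_pow, mul_div_cancel₀ _ hb.ne', pow_mul,
    Real.sq_sqrt hT, neg_div]

lemma tendsto_log_log_sub_log_log_log_atTop (C : ℝ) :
    Tendsto (fun T ↦ Real.log (Real.log T) - Real.log (Real.log (Real.log T)) - C) atTop atTop :=
  tendsto_atTop_add_const_right _ (-C)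
    (tendsto_sub_log_atTop.comp (Real.tendsto_log_atTop.comp Real.tendsto_log_atTop))

lemma exists_isGreatest_norm_iteratedDeriv_riemannZeta {T : ℝ} (hT : 0 < T) (l : ℕ) :
    ∃ M : ℝ, IsGreatest
      ((fun t : ℝ ↦ ‖iteratedDeriv l riemannZeta (1 + (t : ℂ) * I)‖) '' Set.Icc T (2 * T)) M := by
  refine (isCompact_Icc.image_of_continuousOn fun t ht ↦ ?_).exists_isGreatest
    ((Set.nonempty_Icc.mpr (by linarith)).image _)
  have hne : (1 : ℂ) + t * I ≠ 1 :=
    ne_one_of_mem_closedBall_one_add_mul_I (hT.trans_le ht.1) (Metric.mem_closedBall_self le_rfl)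
  have hζ : ContinuousAt (iteratedDeriv l riemannZeta) (1 + t * I) := by
    rw [iteratedDeriv_eq_iterate]
    exact ((analyticOn_riemannZeta _ hne).iterated_deriv l).continuousAt
  exact (hζ.comp (f := fun t : ℝ ↦ (1 : ℂ) + t * I) (by fun_prop)).norm.continuousWithinAt

theorem theorem1_general {c : ℝ} (hc₀ : 0 < c) (hc₁ : c < 1) :
    ∃ C T₀ : ℝ, ∀ T : ℝ, T₀ ≤ T →
      0 ≤ Real.log (Real.log T) - Real.log (Real.log (Real.log T)) - C ∧
      ∀ ℓ : ℕ, (ℓ : ℝ) ≤ Real.log T / Real.log (Real.log T) →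
        ∃ M : ℝ,
          IsGreatest
            ((fun t : ℝ ↦ ‖iteratedDeriv ℓ riemannZeta (1 + (t : ℂ) * I)‖) ''
              Set.Icc T (2 * T)) M ∧
          c / (ℓ + 1) *
            (Real.log (Real.log T) - Real.log (Real.log (Real.log T)) - C) ^ (ℓ + 1) ≤ M := by
  obtain ⟨ε, rfl⟩ : ∃ ε : ℝ, c = 1 - 4 * ε := ⟨(1 - c) / 4, by ring⟩
  have hε : 0 < ε := by linarith
  have hL := (tendsto_log_log_sub_log_log_log_atTop (Real.log (12 / ε))).const_mul_atTop hε
  have hδ := (tendsto_pow_mul_exp_neg_sqrt_atTop 5 (by norm_num : (0 : ℝ) < 16)).const_mul 6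
  rw [mul_zero] at hδ
  obtain ⟨T₀, hT₀⟩ := eventually_atTop.mp ((eventually_ge_atTop (Real.exp (Real.exp 2))).and
    ((hL.eventually_ge_atTop (Real.log ⌈1 / ε⌉₊ + 756)).and (hδ.eventually_le_const hε)))
  refine ⟨Real.log (12 / ε), T₀, fun T hT ↦ ?_⟩
  obtain ⟨hT, hLT, hδT⟩ := hT₀ T hT
  refine ⟨nonneg_of_mul_nonneg_right
    (by linarith [Real.log_natCast_nonneg ⌈1 / ε⌉₊]) hε, fun ℓ hℓ ↦ ?_⟩
  obtain ⟨M, hM⟩ := exists_isGreatest_norm_iteratedDeriv_riemannZeta (pos_of_exp_exp_two_le hT) ℓ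
  rw [← mul_assoc] at hδT
  exact ⟨M, hM, le_of_forall_norm_iteratedDeriv_riemannZeta_le hε (by linarith) hT hℓ hLT hδT
    fun t ht ↦ hM.2 ⟨t, ht, rfl⟩⟩

lemma exp_eulerMascheroniConstant_lt_two : Real.exp Real.eulerMascheroniConstant < 2 := by
  refine lt_of_pow_lt_pow_left₀ 3 zero_le_two ?_
  calc Real.exp Real.eulerMascheroniConstant ^ 3
      = Real.exp (3 * Real.eulerMascheroniConstant) := by rw [← Real.exp_nat_mul]; norm_num
    _ < Real.exp 2 := Real.exp_lt_exp.mpr (by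
      linarith [Real.eulerMascheroniConstant_lt_two_thirds])
    _ = Real.exp 1 ^ 2 := by rw [← Real.exp_nat_mul]; norm_num
    _ ≤ 2.7182818286 ^ 2 := by gcongr; exact Real.exp_one_lt_d9.le
    _ ≤ 2 ^ 3 := by norm_num

lemma two_mul_pow_self_le_add_one_pow {n : ℕ} (hn : 1 ≤ n) :
    2 * (n : ℝ) ^ n ≤ ((n : ℝ) + 1) ^ n := by
  have hn₀ : (0 : ℝ) < n := by exact_mod_cast hn
  have h := one_add_mul_le_pow (a := 1 / (n : ℝ)) (by linarith [one_div_pos.mpr hn₀]) n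
  rw [mul_one_div_cancel hn₀.ne', one_add_one_eq_two, one_add_div hn₀.ne', div_pow,
    le_div_iff₀ (by positivity)] at h
  exact h

lemma mul_pow_mul_inv_pow_succ_le {a : ℝ} (ha : 0 ≤ a) {n : ℕ} (hn : 1 ≤ n) :
    a * (n : ℝ) ^ n * (((n : ℝ) + 1) ^ (n + 1))⁻¹ ≤ a / 2 / (n + 1) := by
  have h := two_mul_pow_self_le_add_one_pow hn
  rw [← div_eq_mul_inv, div_le_div_iff₀ (by positivity) (by positivity), pow_succ]
  calc a * (n : ℝ) ^ n * (n + 1) = a / 2 * (2 * (n : ℝ) ^ n) * (n + 1) := by ring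
    _ ≤ a / 2 * ((n : ℝ) + 1) ^ n * (n + 1) := by gcongr
    _ = _ := by ring

theorem theorem1 :
    ∃ C T₀ : ℝ, ∀ T : ℝ, T₀ ≤ T → ∀ ℓ : ℕ, 1 ≤ ℓ →
      (ℓ : ℝ) ≤ Real.log T / Real.log (Real.log T) →
      ∃ M : ℝ,
        IsGreatest
          ((fun t : ℝ => ‖iteratedDeriv ℓ riemannZeta (1 + (t : ℂ) * Complex.I)‖) ''
            Set.Icc T (2 * T)) M ∧
        Real.exp Real.eulerMascheroniConstant * (ℓ : ℝ) ^ ℓ * (((ℓ : ℝ) + 1) ^ (ℓ + 1))⁻¹ *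
          (Real.log (Real.log T) - Real.log (Real.log (Real.log T)) - C) ^ (ℓ + 1) ≤ M := by
  obtain ⟨C, T₀, h⟩ := theorem1_general (c := Real.exp Real.eulerMascheroniConstant / 2)
    (by positivity) (by linarith [exp_eulerMascheroniConstant_lt_two])
  exact ⟨C, T₀, fun T hT ℓ hℓ₁ hℓ ↦ ((h T hT).2 ℓ hℓ).imp fun M hM ↦ ⟨hM.1,
    (mul_le_mul_of_nonneg_right (mul_pow_mul_inv_pow_succ_le (Real.exp_nonneg _) hℓ₁)
      (pow_nonneg (h T hT).1 _)).trans hM.2⟩⟩
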